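/- Let $\mathcal G$ be a strongly connected directed graph on agents $\mathcal V=\{1,\dots,n\}$ (self-loops allowed), an edge $(i,j)$ meaning that $j$ can send information to $i$. Let $A=(a_{ij})$ be row-stochastic and $B=(b_{ij})$ column-stochastic real $n\times n$ matrices such that $a_{ij}>0$, $b_{ij}>0$ if $(i,j)$ is an edge and $a_{ij}=b_{ij}=0$ otherwise. Put $\Upsilon=\frac{(1-|\lambda_3|)^n}{(20+8n)^n}$, where $|\lambda_3|$ is the third largest modulus among the eigenvalues, counted with algebraic multiplicity, of the $2n\times 2n$ matrix $\begin{pmatrix}A&0\\ I-A&B\end{pmatrix}$ ($|\lambda_3|=0$ if $n=1$). Then there is $\epsilon_0>0$, depending only on $A$ and $B$, such that the following holds for every $\epsilon\in(0,\Upsilon)$ with $\epsilon\le\epsilon_0$. Let $\mathcal X\subseteq\mathbb R^p$ be closed and convex, let $f_i:\mathbb R^p\to\mathbb R$ $(i\in\mathcal V)$ be convex functions whose subgradients at all points of $\mathbb R^p$ are bounded in norm by constants $B_{f_i}$, and let $\alpha_k\ge 0$ be non-increasing with $\sum_{k}\alpha_k=\infty$ and $\sum_k\alpha_k^2<\infty$.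 Let $(\mathbf x_i^k)$, $(\mathbf y_i^k)$ be sequences in $\mathbb R^p$, with arbitrary initial values $\mathbf x_i^0,\mathbf y_i^0$, satisfying for all $k\ge0$ and $i\in\mathcal V$ $$\mathbf x_i^{k+1}=\mathcal P_{\mathcal X}\Big[\sum_{j=1}^n a_{ij}\mathbf x_j^k+\epsilon\mathbf y_i^k-\alpha_k\mathbf d_i^k\Big],\qquad \mathbf y_i^{k+1}=\mathbf x_i^k-\sum_{j=1}^n a_{ij}\mathbf x_j^k+\sum_{j=1}^n b_{ij}\mathbf y_j^k-\epsilon\mathbf y_i^k,$$ where $\mathbf d_i^k$ is a subgradient of $f_i$ at $\mathbf x_i^k$ and $\mathcal P_{\mathcal X}$ is the Euclidean projection on $\mathcal X$. Let $\overline{\mathbf z}^k=\frac1n\sum_{i=1}^n\mathbf x_i^k+\frac1n\sum_{i=1}^n\mathbf y_i^k$ be the accumulation state. Then for every $i\in\mathcal V$: (a) $\lim_{k\to\infty}\|\mathbf x_i^k-\overline{\mathbf z}^k\|=0$; (b) $\lim_{k\to\infty}\|\mathbf y_i^k\|=0$. -/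

import Mathlib

open Filter Topology

noncomputable section

namespace DDPS

/-- Communication digraph on the agents `0, …, n-1`: `G.Adj i j` says that `(i, j)` is an edge,
that is, agent `j` can send information to agent `i`.  Self-loops are allowed.
Strong connectivity: for all `i`, `j` there is a directed path from `j` to `i`. -/
def StronglyConnected {n : ℕ} (G : Digraph (Fin n)) : Prop :=
  ∀ i j : Fin n, Relation.ReflTransGen (fun u v => G.Adj v u) j i

/-- In-weights: `a i j > 0` if `j` is an in-neighbour of `i`, `a i j = 0` otherwise,
and every row sums to one. -/
structure IsInWeight {n : ℕ} (G : Digraph (Fin n)) (a : Matrix (Fin n) (Fin n) ℝ) : Prop where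
  pos : ∀ i j, G.Adj i j → 0 < a i j
  zero : ∀ i j, ¬ G.Adj i j → a i j = 0
  row_sum : ∀ i, ∑ j, a i j = 1

/-- Out-weights: `b i j > 0` if `i` is an out-neighbour of `j`, `b i j = 0` otherwise,
and every column sums to one. -/
structure IsOutWeight {n : ℕ} (G : Digraph (Fin n)) (b : Matrix (Fin n) (Fin n) ℝ) : Prop where
  pos : ∀ i j, G.Adj i j → 0 < b i j
  zero : ∀ i j, ¬ G.Adj i j → b i j = 0
  col_sum : ∀ j, ∑ i, b i j = 1

/-- The `2n × 2n` weighting matrix `M = [[A, ε I], [I - A, B - ε I]]`. -/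
def weightMatrix {n : ℕ} (a b : Matrix (Fin n) (Fin n) ℝ) (ε : ℝ) :
    Matrix (Fin n ⊕ Fin n) (Fin n ⊕ Fin n) ℝ :=
  Matrix.fromBlocks a (ε • (1 : Matrix (Fin n) (Fin n) ℝ)) (1 - a)
    (b - ε • (1 : Matrix (Fin n) (Fin n) ℝ))

/-- The moduli of the complex eigenvalues of a real square matrix, with algebraic multiplicity,
listed in non-increasing order. -/
def eigenvalueModuli {m : Type*} [Fintype m] [DecidableEq m] (M : Matrix m m ℝ) : List ℝ :=
  ((M.map (algebraMap ℝ ℂ)).charpoly.roots.map (fun μ : ℂ => ‖μ‖)).sort (fun s t => s ≥ t)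

/-- The modulus `|λ₃|` of the third largest eigenvalue of the weighting matrix with `ε = 0`
(read as `0` if there are fewer than three eigenvalues, i.e. if `n ≤ 1`). -/
def lambda3Modulus {n : ℕ} (a b : Matrix (Fin n) (Fin n) ℝ) : ℝ :=
  (eigenvalueModuli (weightMatrix a b 0)).getD 2 0

/-- `Υ = (1 - |λ₃|) ^ n / (20 + 8 n) ^ n`. -/
def upsilon {n : ℕ} (a b : Matrix (Fin n) (Fin n) ℝ) : ℝ :=
  1 / (20 + 8 * (n : ℝ)) ^ n * (1 - lambda3Modulus a b) ^ n

/-- `d` is a subgradient of `f` at `v`. -/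
def IsSubgradient {p : ℕ} (f : EuclideanSpace ℝ (Fin p) → ℝ) (v d : EuclideanSpace ℝ (Fin p)) :
    Prop :=
  ∀ w, f v + inner ℝ d (w - v) ≤ f w

/-- `v = argmin_{w ∈ X} ‖w - u‖²`: `v` is the projection of `u` on `X`. -/
def IsProjection {p : ℕ} (X : Set (EuclideanSpace ℝ (Fin p))) (u v : EuclideanSpace ℝ (Fin p)) :
    Prop :=
  v ∈ X ∧ ∀ w ∈ X, ‖v - u‖ ^ 2 ≤ ‖w - u‖ ^ 2

/-- Step sizes: nonnegative, non-increasing, not summable, square summable. -/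
structure IsStepSize (α : ℕ → ℝ) : Prop where
  nonneg : ∀ k, 0 ≤ α k
  antitone : Antitone α
  sum_eq_top : Tendsto (fun K => ∑ k ∈ Finset.range K, α k) atTop atTop
  summable_sq : Summable (fun k => α k ^ 2)

/-- The sequences `x k i`, `y k i` are generated by the projected subgradient iteration
with weights `a`, `b`, parameter `ε`, step sizes `α`, local objectives `f i`, constraint set `X`,
where `d k i` is the subgradient of `f i` at `x k i` used by agent `i` at time `k`.
The initial states `x 0 i`, `y 0 i` are arbitrary. -/
structure IsRun {n p : ℕ} (a b : Matrix (Fin n) (Fin n) ℝ) (ε : ℝ) (α : ℕ → ℝ)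
    (f : Fin n → EuclideanSpace ℝ (Fin p) → ℝ) (X : Set (EuclideanSpace ℝ (Fin p)))
    (x y d : ℕ → Fin n → EuclideanSpace ℝ (Fin p)) : Prop where
  subgradient : ∀ k i, IsSubgradient (f i) (x k i) (d k i)
  x_succ : ∀ k i,
    IsProjection X (∑ j, a i j • x k j + ε • y k i - α k • d k i) (x (k + 1) i)
  y_succ : ∀ k i,
    y (k + 1) i = x k i - ∑ j, a i j • x k j + ∑ j, b i j • y k j - ε • y k i

/-- The stacked states `z k i`: first the `n` estimates `x k i`, then the `n` surpluses `y k i`. -/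
def stackedState {n p : ℕ} (x y : ℕ → Fin n → EuclideanSpace ℝ (Fin p)) (k : ℕ) :
    Fin n ⊕ Fin n → EuclideanSpace ℝ (Fin p) :=
  Sum.elim (x k) (y k)

/-- The accumulation state `z̄ k = (1/n) ∑_{i=1}^{2n} z k i`. -/
def accumulationState {n p : ℕ} (x y : ℕ → Fin n → EuclideanSpace ℝ (Fin p)) (k : ℕ) :
    EuclideanSpace ℝ (Fin p) :=
  (1 / (n : ℝ)) • ∑ i, stackedState x y k i

end DDPS

end

/-! Let `w` and `q` be the positive stationary vectors, `wᵀA = wᵀ` and `Bq = q`, of total mass 1. A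
state is controlled by three errors: the disagreement `δ = x - 1wᵀx`, the imbalance `η = y -
q(1ᵀy)`, and the total gap `S = ∑ x + ∑ y - n wᵀx`. They determine `x i - z̄` and `y i` linearly.

Since `0 < ε < Υ` forces `|λ₃| < 1`, the matrices `A` and `B` have no eigenvalue besides 1 on the
unit circle. Hence `A - 1wᵀ` and `B - q1ᵀ` have spectral radius below one, and `δ`, `η` contract at
a fixed rate in adapted norms.

The gap `S` contracts only at rate `1 - με`, and this must survive the nonlinear projection. By
convexity each projection displacement lies in the ball with diameter from `0` to `ε y i - α d i`
(`IsProjection.norm_sub_half_le`). It enters `S` with weight `1 - n w i`, which is less than 1 as `w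
i > 0`; this gives the rate (`norm_sub_smul_add_sum_le`).

The steps `α d` are a vanishing perturbation. All couplings are `O(ε)` except the one from `δ` to
`η`, which is one-directional, so a weighted sum of the three errors contracts for small `ε`
(`exists_threshold_tendsto_zero`). -/

namespace DDPS

open Matrix

/-! ### Perron theory of irreducible stochastic matrices. -/

section Stochastic

variable {ι : Type*} [Fintype ι]

/-- Row-stochastic matrices whose graph of positive entries is strongly connected. -/
structure IsIrreducibleStochastic (P : Matrix ι ι ℝ) : Prop where
  nonneg : ∀ i j, 0 ≤ P i j
  row_sum : ∀ i, ∑ j, P i j = 1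
  connected : ∀ i j, Relation.ReflTransGen (fun u v => 0 < P u v) i j

/-- The complex form of a real matrix. -/
noncomputable abbrev complexify (P : Matrix ι ι ℝ) : Matrix ι ι ℂ := P.map (algebraMap ℝ ℂ)

theorem isRoot_charpoly_iff_exists_mulVec {K : Type*} [Field K] [DecidableEq ι]
    (T : Matrix ι ι K) (z : K) :
    T.charpoly.IsRoot z ↔ ∃ v ≠ 0, T *ᵥ v = z • v := by
  rw [Polynomial.IsRoot.def, Matrix.eval_charpoly, ← Matrix.exists_mulVec_eq_zero_iff]
  refine exists_congr fun v => and_congr_right fun _ => ?_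
  rw [Matrix.sub_mulVec, sub_eq_zero, eq_comm, Matrix.scalar_apply, ← Matrix.smul_one_eq_diagonal,
    Matrix.smul_mulVec, Matrix.one_mulVec]

namespace IsIrreducibleStochastic

variable {P : Matrix ι ι ℝ}

theorem mulVec_one (hP : IsIrreducibleStochastic P) : P *ᵥ 1 = 1 := by
  ext i
  simp [Matrix.mulVec, dotProduct, hP.row_sum i]

/-- A harmonic function of an irreducible stochastic matrix is constant. -/
theorem eq_of_mulVec_eq_self (hP : IsIrreducibleStochastic P) {v : ι → ℝ} (hv : P *ᵥ v = v)
    (i j : ι) : v i = v j := by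
  have : Nonempty ι := ⟨i⟩
  -- Maximum principle: where `v` is maximal, the weighted deficits sum to zero, so every
  -- out-neighbour is maximal too. Maximality then spreads along paths.
  obtain ⟨m, hm⟩ := Finite.exists_max v
  suffices h : ∀ j, v j = v m from (h i).trans (h j).symm
  intro j
  induction hP.connected m j with
  | refl => rfl
  | @tail k l _ hkl ih =>
    have h0 : ∑ q, P k q * (v m - v q) = 0 := by
      have h1 : ∑ q, P k q * v q = v k := congrFun hv k
      simp only [mul_sub, Finset.sum_sub_distrib, ← Finset.sum_mul, hP.row_sum, h1, ih, one_mul,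
        sub_self]
    have h2 := (Finset.sum_eq_zero_iff_of_nonneg fun q _ =>
      mul_nonneg (hP.nonneg k q) (sub_nonneg.2 (hm q))).1 h0 l (Finset.mem_univ l)
    rcases mul_eq_zero.1 h2 with h3 | h3
    · exact absurd h3 hkl.ne'
    · linarith

/-- The stationary distribution of an irreducible stochastic matrix. -/
theorem exists_stationary [Nonempty ι] (hP : IsIrreducibleStochastic P) :
    ∃ w : ι → ℝ, (∀ i, 0 < w i) ∧ ∑ i, w i = 1 ∧ w ᵥ* P = w := by
  classical
  have hdet : (P - 1).det = 0 :=
    Matrix.exists_mulVec_eq_zero_iff.1 ⟨1, one_ne_zero, by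
      rw [Matrix.sub_mulVec, hP.mulVec_one, Matrix.one_mulVec, sub_self]⟩
  obtain ⟨w, hw0, hw⟩ := Matrix.exists_vecMul_eq_zero_iff.2 hdet
  rw [Matrix.vecMul_sub, Matrix.vecMul_one, sub_eq_zero] at hw
  -- The two sides have the same total because rows sum to one, so each inequality is an equality:
  -- `|w|` is itself invariant, and its positivity spreads along edges.
  have hle : ∀ j ∈ Finset.univ, |w j| ≤ ∑ i, |w i| * P i j := by
    intro j _
    calc |w j| = |∑ i, w i * P i j| := by rw [← congrFun hw j]; rfl
      _ ≤ ∑ i, |w i * P i j| := Finset.abs_sum_le_sum_abs _ _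
      _ = _ := by simp only [abs_mul, abs_of_nonneg (hP.nonneg _ _)]
  have hsum : ∑ j, |w j| = ∑ j, ∑ i, |w i| * P i j := by
    rw [Finset.sum_comm]
    simp only [← Finset.mul_sum, hP.row_sum, mul_one]
  have heq := (Finset.sum_eq_sum_iff_of_le hle).1 hsum
  obtain ⟨i₀, hi₀⟩ : ∃ i, w i ≠ 0 := by
    by_contra! h
    exact hw0 (funext h)
  have hpos : ∀ j, 0 < |w j| := by
    intro j
    induction hP.connected i₀ j with
    | refl => exact abs_pos.2 hi₀
    | @tail k l _ hkl ih =>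
      rw [heq l (Finset.mem_univ l)]
      exact Finset.sum_pos' (fun i _ => mul_nonneg (abs_nonneg _) (hP.nonneg i l))
        ⟨k, Finset.mem_univ k, mul_pos ih hkl⟩
  have hs : 0 < ∑ i, |w i| := Finset.sum_pos (fun i _ => hpos i) Finset.univ_nonempty
  refine ⟨fun i => |w i| / ∑ i, |w i|, fun i => div_pos (hpos i) hs, ?_, ?_⟩
  · rw [← Finset.sum_div, div_self hs.ne']
  · ext j
    simp only [Matrix.vecMul, dotProduct, div_mul_eq_mul_div]
    rw [← Finset.sum_div, ← heq j (Finset.mem_univ j)]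

variable [DecidableEq ι]

theorem norm_le_one_of_isRoot (hP : IsIrreducibleStochastic P) {z : ℂ}
    (hz : (complexify P).charpoly.IsRoot z) : ‖z‖ ≤ 1 := by
  obtain ⟨v, hv0, hv⟩ := (isRoot_charpoly_iff_exists_mulVec _ _).1 hz
  obtain ⟨i₀, hi₀⟩ : ∃ i, v i ≠ 0 := by
    by_contra! h
    exact hv0 (funext h)
  have : Nonempty ι := ⟨i₀⟩
  obtain ⟨m, hm⟩ := Finite.exists_max fun i => ‖v i‖
  have hpos : 0 < ‖v m‖ := (norm_pos_iff.2 hi₀).trans_le (hm i₀)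
  have h : ‖z‖ * ‖v m‖ ≤ 1 * ‖v m‖ := by
    calc ‖z‖ * ‖v m‖ = ‖∑ j, (P m j : ℂ) * v j‖ := by
          rw [← norm_mul, ← smul_eq_mul, ← Pi.smul_apply, ← hv]; rfl
      _ ≤ ∑ j, ‖(P m j : ℂ) * v j‖ := norm_sum_le _ _
      _ ≤ ∑ j, P m j * ‖v m‖ := by
          refine Finset.sum_le_sum fun j _ => ?_
          rw [norm_mul, Complex.norm_real, Real.norm_of_nonneg (hP.nonneg m j)]
          exact mul_le_mul_of_nonneg_left (hm j) (hP.nonneg m j)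
      _ = 1 * ‖v m‖ := by rw [← Finset.sum_mul, hP.row_sum]
  exact le_of_mul_le_mul_right h hpos

theorem isRoot_one [Nonempty ι] (hP : IsIrreducibleStochastic P) :
    (complexify P).charpoly.IsRoot 1 := by
  refine (isRoot_charpoly_iff_exists_mulVec _ _).2 ⟨1, one_ne_zero, ?_⟩
  ext i
  have := congrArg (fun t : ℝ => (t : ℂ)) (hP.row_sum i)
  simpa [Matrix.mulVec, dotProduct] using this

/-- Removing the Perron projection leaves a matrix of spectral radius below one,
if one is the only eigenvalue on the unit circle. -/
theorem norm_lt_one_of_isRoot_sub (hP : IsIrreducibleStochastic P) {w : ι → ℝ}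
    (hw1 : ∑ i, w i = 1) (hwP : w ᵥ* P = w)
    (hgap : ∀ z, (complexify P).charpoly.IsRoot z → z ≠ 1 → ‖z‖ < 1) {z : ℂ}
    (hz : (complexify (P - Matrix.of fun _ j => w j)).charpoly.IsRoot z) : ‖z‖ < 1 := by
  obtain ⟨v, hv0, hv⟩ := (isRoot_charpoly_iff_exists_mulVec _ _).1 hz
  by_contra! hz1
  have hcomp : ∀ i, ∑ j, (P i j : ℂ) * v j - ∑ j, (w j : ℂ) * v j = z * v i := by
    intro i
    rw [← Finset.sum_sub_distrib, ← smul_eq_mul, ← Pi.smul_apply, ← hv]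
    simp [Matrix.mulVec, dotProduct, sub_mul]
  have hwPj : ∀ j, ∑ i, (w i : ℂ) * P i j = w j := by
    intro j
    exact_mod_cast congrFun hwP j
  have hw1' : ∑ i, (w i : ℂ) = 1 := by exact_mod_cast hw1
  -- Pairing the eigenvalue equation with `w` annihilates the left side, and `z ≠ 0`. So `v` is an
  -- eigenvector of `P` itself.
  have hmean : ∑ j, (w j : ℂ) * v j = 0 := by
    have h1 : ∑ i, (w i : ℂ) * (z * v i) = 0 := by
      simp only [← hcomp, mul_sub, Finset.sum_sub_distrib]
      rw [← Finset.sum_mul, hw1', one_mul]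
      simp only [Finset.mul_sum, ← mul_assoc]
      rw [Finset.sum_comm]
      simp only [← Finset.sum_mul, hwPj, sub_self]
    have h2 : z * ∑ j, (w j : ℂ) * v j = 0 := by
      rw [← h1, Finset.mul_sum]
      exact Finset.sum_congr rfl fun i _ => by ring
    rcases mul_eq_zero.1 h2 with h | h
    · rw [h, norm_zero] at hz1
      linarith
    · exact h
  have hPv : complexify P *ᵥ v = z • v := by
    ext i
    have := hcomp i
    rw [hmean, sub_zero] at this
    exact this
  have hzone : z = 1 := by
    by_contra hne
    exact absurd (hgap z ((isRoot_charpoly_iff_exists_mulVec _ _).2 ⟨v, hv0, hPv⟩) hne)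
      (not_lt.2 hz1)
  have hPi : ∀ i, ∑ j, (P i j : ℂ) * v j = v i := by
    intro i
    have := congrFun hPv i
    rw [hzone, one_smul] at this
    exact this
  -- With `z = 1` the real and imaginary parts are harmonic, hence constant; zero `w`-mean then
  -- makes `v` vanish.
  have hre : P *ᵥ (fun j => (v j).re) = fun j => (v j).re := by
    ext i
    have := congrArg Complex.re (hPi i)
    simpa [Matrix.mulVec, dotProduct] using this
  have him : P *ᵥ (fun j => (v j).im) = fun j => (v j).im := by
    ext i
    have := congrArg Complex.im (hPi i)
    simpa [Matrix.mulVec, dotProduct] using this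
  refine hv0 (funext fun i => ?_)
  have hconst : ∀ j, v j = v i := fun j =>
    Complex.ext (hP.eq_of_mulVec_eq_self hre j i) (hP.eq_of_mulVec_eq_self him j i)
  simp only [hconst, ← Finset.sum_mul, hw1', one_mul] at hmean
  exact hmean

end IsIrreducibleStochastic

/-- A real matrix of spectral radius below one has a power that is small
in the maximal absolute row sum. -/
theorem exists_pow_row_sum_le [DecidableEq ι] (T : Matrix ι ι ℝ)
    (hT : ∀ z, (complexify T).charpoly.IsRoot z → ‖z‖ < 1) :
    ∃ (m : ℕ) (θ : ℝ), 0 < m ∧ 0 < θ ∧ θ < 1 ∧ ∀ i, ∑ j, |(T ^ m) i j| ≤ θ ^ m := by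
  rcases isEmpty_or_nonempty ι with hι | hι
  · exact ⟨1, 1 / 2, one_pos, by norm_num, by norm_num, fun i => hι.elim i⟩
  -- Gelfand's formula in the maximal-row-sum norm, with `θ` strictly between the spectral radius
  -- and 1.
  let _ : NormedRing (Matrix ι ι ℂ) := Matrix.linftyOpNormedRing
  let _ : NormedAlgebra ℂ (Matrix ι ι ℂ) := Matrix.linftyOpNormedAlgebra
  have _ : CompleteSpace (Matrix ι ι ℂ) := FiniteDimensional.complete ℂ _
  have hr : spectralRadius ℂ (complexify T) < (1 : NNReal) := by
    refine spectrum.spectralRadius_lt_of_forall_lt _ fun z hz => ?_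
    exact_mod_cast hT z (Matrix.mem_spectrum_iff_isRoot_charpoly.1 hz)
  obtain ⟨θ, hθ₁, hθ₂⟩ := ENNReal.lt_iff_exists_nnreal_btwn.1 hr
  have hθ1 : θ < 1 := by exact_mod_cast hθ₂
  have hθ0 : 0 < θ := by
    have := bot_le.trans_lt hθ₁
    rw [bot_eq_zero] at this
    exact_mod_cast this
  have hlim := spectrum.pow_nnnorm_pow_one_div_tendsto_nhds_spectralRadius (complexify T)
  obtain ⟨m, hm, hm0⟩ := ((hlim.eventually_lt_const hθ₁).and (eventually_gt_atTop 0)).exists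
  refine ⟨m, θ, hm0, hθ0, hθ1, fun i => ?_⟩
  have h1 : ‖complexify T ^ m‖₊ ≤ θ ^ m := by
    have h2 := ENNReal.rpow_le_rpow hm.le (Nat.cast_nonneg (α := ℝ) m)
    rw [← ENNReal.rpow_mul, one_div, inv_mul_cancel₀ (by positivity), ENNReal.rpow_one,
      ENNReal.rpow_natCast] at h2
    exact_mod_cast h2
  have h3 : ∑ j, ‖(complexify T ^ m) i j‖₊ ≤ ‖complexify T ^ m‖₊ := by
    rw [Matrix.linfty_opNNNorm_def]
    exact Finset.le_sup (f := fun i => ∑ j, ‖(complexify T ^ m) i j‖₊) (Finset.mem_univ i)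
  have h4 : ∀ j, ‖(complexify T ^ m) i j‖ = |(T ^ m) i j| := by
    intro j
    have h5 : complexify T ^ m = complexify (T ^ m) :=
      (map_pow (algebraMap ℝ ℂ).mapMatrix T m).symm
    rw [h5]
    simp
  simp only [← h4]
  have h6 := NNReal.coe_le_coe.2 (h3.trans h1)
  push_cast at h6
  exact h6

end Stochastic

/-! ### From `Υ > 0` to a spectral gap for both weight matrices. -/

section SpectralGap

variable {n : ℕ} {G : Digraph (Fin n)} {a b : Matrix (Fin n) (Fin n) ℝ}

theorem IsInWeight.isIrreducibleStochastic (ha : IsInWeight G a) (hG : StronglyConnected G) :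
    IsIrreducibleStochastic a where
  nonneg i j := by
    by_cases h : G.Adj i j
    · exact (ha.pos i j h).le
    · exact (ha.zero i j h).ge
  row_sum := ha.row_sum
  connected i j :=
    Relation.ReflTransGen.mono (fun u v h => ha.pos u v h) _ _
      (Relation.reflTransGen_swap.1 (hG i j))

theorem IsOutWeight.isIrreducibleStochastic_transpose (hb : IsOutWeight G b)
    (hG : StronglyConnected G) : IsIrreducibleStochastic bᵀ where
  nonneg i j := by
    by_cases h : G.Adj j i
    · exact (hb.pos j i h).le
    · exact (hb.zero j i h).ge
  row_sum := hb.col_sum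
  connected i j := Relation.ReflTransGen.mono (fun u v h => hb.pos v u h) _ _ (hG j i)

theorem countP_le_two_of_getD_lt {l : List ℝ} (hl : l.Pairwise (· ≥ ·)) (h : l.getD 2 0 < 1) :
    l.countP (fun t => decide (1 ≤ t)) ≤ 2 := by
  match l with
  | [] => simp
  | [_] => exact List.countP_le_length.trans (by simp)
  | [_, _] => exact List.countP_le_length
  | s :: t :: r :: l =>
    have hr : r < 1 := h
    have h0 : (r :: l).countP (fun t => decide (1 ≤ t)) = 0 := by
      rw [List.countP_eq_zero]
      intro q hq
      have hqr : q ≤ r := by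
        rcases List.mem_cons.1 hq with rfl | hq
        · exact le_rfl
        · exact List.rel_of_pairwise_cons (List.Pairwise.of_cons (List.Pairwise.of_cons hl)) hq
      simpa using hqr.trans_lt hr
    rw [List.countP_cons, List.countP_cons, h0]
    split_ifs <;> omega

theorem charpoly_complexify_weightMatrix_zero (a b : Matrix (Fin n) (Fin n) ℝ) :
    (complexify (weightMatrix a b 0)).charpoly =
      (complexify a).charpoly * (complexify b).charpoly := by
  rw [weightMatrix, zero_smul, sub_zero, complexify, Matrix.fromBlocks_map,
    Matrix.map_zero _ (map_zero _), Matrix.charpoly_fromBlocks_zero₁₂]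

theorem roots_charpoly_complexify_weightMatrix_zero (a b : Matrix (Fin n) (Fin n) ℝ) :
    (complexify (weightMatrix a b 0)).charpoly.roots =
      (complexify a).charpoly.roots + (complexify b).charpoly.roots := by
  rw [charpoly_complexify_weightMatrix_zero, Polynomial.roots_mul
    (mul_ne_zero (Matrix.charpoly_monic _).ne_zero (Matrix.charpoly_monic _).ne_zero)]

theorem charpoly_complexify_transpose (b : Matrix (Fin n) (Fin n) ℝ) :
    (complexify bᵀ).charpoly = (complexify b).charpoly := by
  rw [complexify, Matrix.transpose_map, Matrix.charpoly_transpose]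

theorem lambda3Modulus_le_one (ha : IsIrreducibleStochastic a)
    (hb : IsIrreducibleStochastic bᵀ) : lambda3Modulus a b ≤ 1 := by
  rw [lambda3Modulus]
  rcases lt_or_ge 2 (eigenvalueModuli (weightMatrix a b 0)).length with h | h
  · rw [List.getD_eq_getElem _ _ h]
    have hmem := List.getElem_mem h
    obtain ⟨z, hz, hzeq⟩ := Multiset.mem_map.1 ((Multiset.mem_sort _).1 hmem)
    rw [← hzeq]
    rw [roots_charpoly_complexify_weightMatrix_zero, Multiset.mem_add] at hz
    rcases hz with hz | hz
    · exact ha.norm_le_one_of_isRoot (Polynomial.isRoot_of_mem_roots hz)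
    · refine hb.norm_le_one_of_isRoot ?_
      rw [charpoly_complexify_transpose]
      exact Polynomial.isRoot_of_mem_roots hz
  · rw [List.getD_eq_default _ _ h]
    exact zero_le_one

/-- At `|λ₃| = 1` the factor `(1 - |λ₃|) ^ n` would vanish, as `n ≥ 1`. -/
theorem lambda3Modulus_lt_one [NeZero n] (ha : IsIrreducibleStochastic a)
    (hb : IsIrreducibleStochastic bᵀ) (h : 0 < upsilon a b) : lambda3Modulus a b < 1 := by
  refine lt_of_le_of_ne (lambda3Modulus_le_one ha hb) fun h1 => ?_
  rw [upsilon, h1, sub_self, zero_pow (NeZero.ne n), mul_zero] at h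
  exact lt_irrefl _ h

/-- The two ones, one from each spectrum, already fill the two places allowed for modulus at least
1; a further `z ≠ 1` on or outside the unit circle would be a third. -/
theorem norm_lt_one_of_mem_roots {R R' : Multiset ℂ} (hR : 1 ∈ R) (hR' : 1 ∈ R')
    (h : (((R + R').map fun z : ℂ => ‖z‖).sort (fun s t => s ≥ t)).getD 2 0 < 1) {z : ℂ}
    (hz : z ∈ R) (hz1 : z ≠ 1) : ‖z‖ < 1 := by
  by_contra! hz'
  have hcount := countP_le_two_of_getD_lt (Multiset.pairwise_sort _ _) h
  obtain ⟨R₁, rfl⟩ := Multiset.exists_cons_of_mem hR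
  obtain ⟨R₂, rfl⟩ := Multiset.exists_cons_of_mem ((Multiset.mem_cons.1 hz).resolve_left hz1)
  obtain ⟨R₃, rfl⟩ := Multiset.exists_cons_of_mem hR'
  have hm : Multiset.countP (fun t : ℝ => 1 ≤ t)
      (((1 ::ₘ z ::ₘ R₂) + (1 ::ₘ R₃)).map fun z : ℂ => ‖z‖) ≤ 2 := by
    rw [← Multiset.sort_eq (((1 ::ₘ z ::ₘ R₂) + (1 ::ₘ R₃)).map fun z : ℂ => ‖z‖)
      (fun s t => s ≥ t), Multiset.coe_countP]
    exact hcount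
  simp [hz'] at hm

theorem norm_lt_one_of_isRoot_charpoly [Nonempty (Fin n)] (ha : IsIrreducibleStochastic a)
    (hb : IsIrreducibleStochastic bᵀ) (h : lambda3Modulus a b < 1) :
    (∀ z, (complexify a).charpoly.IsRoot z → z ≠ 1 → ‖z‖ < 1) ∧
      ∀ z, (complexify bᵀ).charpoly.IsRoot z → z ≠ 1 → ‖z‖ < 1 := by
  have hmem : ∀ (c : Matrix (Fin n) (Fin n) ℝ) z, (complexify c).charpoly.IsRoot z →
      z ∈ (complexify c).charpoly.roots := fun c z hz =>
    (Polynomial.mem_roots (Matrix.charpoly_monic _).ne_zero).2 hz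
  have h1a := hmem a 1 ha.isRoot_one
  have h1b := hmem bᵀ 1 hb.isRoot_one
  have hl := h
  rw [lambda3Modulus, eigenvalueModuli, roots_charpoly_complexify_weightMatrix_zero,
    ← charpoly_complexify_transpose b] at hl
  refine ⟨fun z hz => norm_lt_one_of_mem_roots h1a h1b hl (hmem a z hz), fun z hz =>
    norm_lt_one_of_mem_roots h1b h1a ?_ (hmem _ z hz)⟩
  rw [add_comm]
  exact hl

end SpectralGap

/-! ### Scalar recursions for the coupled errors. -/

section Recursion

/-- A sequence that contracts up to a vanishing perturbation vanishes. -/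
theorem tendsto_zero_of_le_mul_add {V τ : ℕ → ℝ} {q : ℝ} (hq0 : 0 ≤ q) (hq1 : q < 1)
    (hV : ∀ k, 0 ≤ V k) (hτ : Tendsto τ atTop (𝓝 0))
    (h : ∀ k, V (k + 1) ≤ q * V k + τ k) : Tendsto V atTop (𝓝 0) := by
  rw [Metric.tendsto_atTop]
  intro e he
  have h1q : 0 < 1 - q := sub_pos.2 hq1
  obtain ⟨N, hN⟩ := eventually_atTop.1
    (hτ.eventually_le_const (show (0 : ℝ) < (1 - q) * (e / 2) by positivity))
  have hle : ∀ k, V (N + k) ≤ q ^ k * V N + e / 2 := by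
    intro k
    induction k with
    | zero => simpa using (by positivity : 0 ≤ e / 2)
    | succ k ih =>
      calc V (N + (k + 1)) ≤ q * V (N + k) + τ (N + k) := h _
        _ ≤ q * (q ^ k * V N + e / 2) + (1 - q) * (e / 2) :=
            add_le_add (mul_le_mul_of_nonneg_left ih hq0) (hN _ (Nat.le_add_right _ _))
        _ = q ^ (k + 1) * V N + e / 2 := by ring
  have hpow : Tendsto (fun k => q ^ k * V N) atTop (𝓝 0) := by
    simpa using (tendsto_pow_atTop_nhds_zero_of_lt_one hq0 hq1).mul_const (V N)
  obtain ⟨M, hM⟩ := eventually_atTop.1 (hpow.eventually_lt_const (half_pos he))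
  refine ⟨N + M, fun k hk => ?_⟩
  obtain ⟨l, rfl⟩ := Nat.exists_eq_add_of_le (le_of_add_le_left hk : N ≤ k)
  rw [Real.dist_0_eq_abs, abs_of_nonneg (hV _)]
  have := hle l
  have := hM l (by omega)
  linarith

/-- Three coupled error sequences: one contracts at a rate `1 - με`, the two others at a fixed rate,
and the feedback into the slow one has size `ε`. For small `ε` all three vanish. -/
theorem exists_threshold_tendsto_zero {μ θ C : ℝ} (hμ : 0 < μ) (hθ0 : 0 ≤ θ) (hθ1 : θ < 1)
    (hC : 0 ≤ C) :
    ∃ ε₀ : ℝ, 0 < ε₀ ∧ ∀ ε : ℝ, 0 < ε → ε ≤ ε₀ → ∀ s u v τ : ℕ → ℝ,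
      (∀ k, 0 ≤ s k) → (∀ k, 0 ≤ u k) → (∀ k, 0 ≤ v k) → Tendsto τ atTop (𝓝 0) →
      (∀ k, s (k + 1) ≤ (1 - μ * ε) * s k + C * ε * (u k + v k) + τ k) →
      (∀ k, u (k + 1) ≤ θ * u k + C * ε * (s k + u k + v k) + τ k) →
      (∀ k, v (k + 1) ≤ θ * v k + C * u k + C * ε * (s k + u k + v k) + τ k) →
      Tendsto s atTop (𝓝 0) ∧ Tendsto u atTop (𝓝 0) ∧ Tendsto v atTop (𝓝 0) := by
  -- The Lyapunov function is `s + K u + L v`. Small `K` and `L` keep the feedback into `s` below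
  -- half of its decay `με`; `L` is moreover so small compared with `K` that the term `C u` in the
  -- bound for `v`, which has no factor `ε`, is absorbed by the contraction of `u`.
  set K : ℝ := μ / (4 * (C + 1)) with hK
  set L : ℝ := K * (1 - θ) / (2 * (C + 1)) with hL
  have h1θ : 0 < 1 - θ := sub_pos.2 hθ1
  have hKpos : 0 < K := by positivity
  have hLpos : 0 < L := by positivity
  have hLK : L ≤ K := by
    rw [hL, div_le_iff₀ (by positivity)]
    nlinarith
  have hKC : (K + L) * C ≤ μ / 2 := by
    have : K * (C + 1) = μ / 4 := by rw [hK]; field_simp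
    nlinarith
  have hLC : L * C ≤ K * (1 - θ) / 2 := by
    have : L * (C + 1) = K * (1 - θ) / 2 := by rw [hL]; field_simp
    nlinarith
  have hden : 0 < C + μ / 2 + μ / 2 * K := by positivity
  refine ⟨min (min 1 (1 / μ)) (L * (1 - θ) / 2 / (C + μ / 2 + μ / 2 * K)), by positivity,
    fun ε hε hε₀ s u v τ hs hu hv hτ h1 h2 h3 => ?_⟩
  have hεμ : μ * ε ≤ 1 := by
    have := (hε₀.trans (min_le_left _ _)).trans (min_le_right _ _)
    rw [le_div_iff₀ hμ] at this
    linarith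
  have hε2 : ε * (C + μ / 2 + μ / 2 * K) ≤ L * (1 - θ) / 2 :=
    (le_div_iff₀ hden).1 (hε₀.trans (min_le_right _ _))
  have hV : Tendsto (fun k => s k + K * u k + L * v k) atTop (𝓝 0) := by
    refine tendsto_zero_of_le_mul_add (q := 1 - μ / 2 * ε) (τ := fun k => (1 + K + L) * τ k)
      (by linarith) (by linarith [mul_pos hμ hε]) (fun k => ?_) (by simpa using hτ.const_mul _)
      fun k => ?_
    · have := hs k
      have := mul_nonneg hKpos.le (hu k)
      have := mul_nonneg hLpos.le (hv k)
      positivity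
    · have e1 := h1 k
      have e2 := mul_le_mul_of_nonneg_left (h2 k) hKpos.le
      have e3 := mul_le_mul_of_nonneg_left (h3 k) hLpos.le
      have cs : 1 - μ * ε + (K + L) * C * ε ≤ 1 - μ / 2 * ε := by nlinarith
      have hKLε : (K + L) * C * ε ≤ μ / 2 * ε := mul_le_mul_of_nonneg_right hKC hε.le
      have cu : C * ε + K * θ + L * C + (K + L) * C * ε ≤ (1 - μ / 2 * ε) * K := by
        nlinarith [mul_le_mul_of_nonneg_right hLK h1θ.le]
      have cv : C * ε + L * θ + (K + L) * C * ε ≤ (1 - μ / 2 * ε) * L := by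
        have : μ / 2 * ε * L ≤ μ / 2 * ε * K := mul_le_mul_of_nonneg_left hLK (by positivity)
        nlinarith [mul_pos hLpos h1θ]
      have f1 := mul_le_mul_of_nonneg_right cs (hs k)
      have f2 := mul_le_mul_of_nonneg_right cu (hu k)
      have f3 := mul_le_mul_of_nonneg_right cv (hv k)
      linear_combination e1 + e2 + e3 + f1 + f2 + f3
  refine ⟨squeeze_zero hs (fun k => ?_) hV,
    squeeze_zero hu (fun k => ?_) (by simpa using hV.const_mul K⁻¹),
    squeeze_zero hv (fun k => ?_) (by simpa using hV.const_mul L⁻¹)⟩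
  · have := mul_nonneg hKpos.le (hu k)
    have := mul_nonneg hLpos.le (hv k)
    linarith
  · rw [le_inv_mul_iff₀ hKpos]
    have := mul_nonneg hLpos.le (hv k)
    linarith [hs k]
  · rw [le_inv_mul_iff₀ hLpos]
    have := mul_nonneg hKpos.le (hu k)
    linarith [hs k]

end Recursion

/-! ### Matrices acting on families of vectors, and adapted norms. -/

section Action

variable {ι : Type*} [Fintype ι] {E : Type*} [NormedAddCommGroup E] [NormedSpace ℝ E]

/-- The action of a scalar matrix on families of vectors. -/
noncomputable def act (T : Matrix ι ι ℝ) : (ι → E) →ₗ[ℝ] (ι → E) where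
  toFun v i := ∑ j, T i j • v j
  map_add' v w := by
    ext i
    simp [Finset.sum_add_distrib]
  map_smul' c v := by
    ext i
    simp [Finset.smul_sum, smul_comm c]

theorem act_apply (T : Matrix ι ι ℝ) (v : ι → E) (i : ι) : act T v i = ∑ j, T i j • v j := rfl

theorem act_mul (S T : Matrix ι ι ℝ) (v : ι → E) : act (S * T) v = act S (act T v) := by
  ext i
  simp only [act_apply, Matrix.mul_apply, Finset.sum_smul, Finset.smul_sum, mul_smul]
  exact Finset.sum_comm

theorem act_one [DecidableEq ι] (v : ι → E) : act (1 : Matrix ι ι ℝ) v = v := by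
  ext i
  simp [act_apply, Matrix.one_apply]

theorem act_sub (S T : Matrix ι ι ℝ) (v : ι → E) : act (S - T) v = act S v - act T v := by
  ext i
  simp [act_apply, sub_smul, Finset.sum_sub_distrib]

theorem norm_act_le {T : Matrix ι ι ℝ} {c : ℝ} (hc : 0 ≤ c) (hT : ∀ i, ∑ j, |T i j| ≤ c)
    (v : ι → E) : ‖act T v‖ ≤ c * ‖v‖ := by
  refine (pi_norm_le_iff_of_nonneg (by positivity)).2 fun i => ?_
  calc ‖∑ j, T i j • v j‖ ≤ ∑ j, ‖T i j • v j‖ := norm_sum_le _ _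
    _ ≤ ∑ j, |T i j| * ‖v‖ := Finset.sum_le_sum fun j _ => by
        rw [norm_smul, Real.norm_eq_abs]
        exact mul_le_mul_of_nonneg_left (norm_le_pi_norm v j) (abs_nonneg _)
    _ ≤ c * ‖v‖ := by
        rw [← Finset.sum_mul]
        exact mul_le_mul_of_nonneg_right (hT i) (norm_nonneg _)

/-- The sum of the absolute values of all entries. -/
def entrySum (T : Matrix ι ι ℝ) : ℝ := ∑ i, ∑ j, |T i j|

theorem entrySum_nonneg (T : Matrix ι ι ℝ) : 0 ≤ entrySum T := by
  unfold entrySum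
  positivity

theorem norm_act_le_entrySum (T : Matrix ι ι ℝ) (v : ι → E) :
    ‖act T v‖ ≤ entrySum T * ‖v‖ := by
  refine norm_act_le (entrySum_nonneg T) (fun i => ?_) v
  have h : ∀ k ∈ Finset.univ, 0 ≤ ∑ j, |T k j| := fun k _ =>
    Finset.sum_nonneg fun j _ => abs_nonneg _
  exact Finset.single_le_sum h (Finset.mem_univ i)

variable [DecidableEq ι]

/-- The norm `∑_{l < m} θ⁻ˡ ‖Tˡ v‖`, contracted by `T` if `‖Tᵐ‖ ≤ θᵐ`. -/
noncomputable def adaptedNorm (T : Matrix ι ι ℝ) (θ : ℝ) (m : ℕ) (v : ι → E) : ℝ :=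
  ∑ l ∈ Finset.range m, (θ ^ l)⁻¹ * ‖act (T ^ l) v‖

variable {T : Matrix ι ι ℝ} {θ : ℝ} {m : ℕ}

theorem adaptedNorm_add_le (hθ : 0 < θ) (v w : ι → E) :
    adaptedNorm T θ m (v + w) ≤ adaptedNorm T θ m v + adaptedNorm T θ m w := by
  rw [adaptedNorm, adaptedNorm, adaptedNorm, ← Finset.sum_add_distrib]
  refine Finset.sum_le_sum fun l _ => ?_
  rw [← mul_add, map_add]
  exact mul_le_mul_of_nonneg_left (norm_add_le _ _) (by positivity)

theorem norm_le_adaptedNorm (hθ : 0 < θ) (hm : 0 < m) (v : ι → E) :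
    ‖v‖ ≤ adaptedNorm T θ m v := by
  have h := Finset.single_le_sum (f := fun l => (θ ^ l)⁻¹ * ‖act (T ^ l) v‖)
    (fun l _ => by positivity) (Finset.mem_range.2 hm)
  rwa [pow_zero, pow_zero, act_one, inv_one, one_mul] at h

theorem adaptedNorm_act_le (hθ : 0 < θ) (hT : ∀ i, ∑ j, |(T ^ m) i j| ≤ θ ^ m) (v : ι → E) :
    adaptedNorm T θ m (act T v) ≤ θ * adaptedNorm T θ m v := by
  have hstep : ∀ l, (θ ^ l)⁻¹ * ‖act (T ^ l) (act T v)‖ =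
      θ * ((θ ^ (l + 1))⁻¹ * ‖act (T ^ (l + 1)) v‖) := by
    intro l
    rw [← act_mul, ← pow_succ, pow_succ θ l, mul_inv]
    field_simp
  -- Applying `T` shifts the sum by one index; the new last term is at most the first term that
  -- drops out.
  have hlast : (θ ^ m)⁻¹ * ‖act (T ^ m) v‖ ≤ (θ ^ 0)⁻¹ * ‖act (T ^ 0) v‖ := by
    rw [pow_zero, pow_zero, act_one, inv_one, one_mul, inv_mul_le_iff₀ (by positivity)]
    exact norm_act_le (by positivity) hT v
  simp only [adaptedNorm, hstep, ← Finset.mul_sum]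
  refine mul_le_mul_of_nonneg_left ?_ hθ.le
  have h := (Finset.sum_range_succ' (fun l => (θ ^ l)⁻¹ * ‖act (T ^ l) v‖) m).symm.trans
    (Finset.sum_range_succ (fun l => (θ ^ l)⁻¹ * ‖act (T ^ l) v‖) m)
  linarith

/-- The constant is chosen before the space `E`, so that one threshold for `ε` serves every
dimension `p`. -/
theorem exists_adaptedNorm_le (T : Matrix ι ι ℝ) {θ : ℝ} (hθ : 0 < θ) (m : ℕ) :
    ∃ c : ℝ, 0 ≤ c ∧ ∀ {E : Type*} [NormedAddCommGroup E] [NormedSpace ℝ E] (v : ι → E),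
      adaptedNorm T θ m v ≤ c * ‖v‖ := by
  refine ⟨∑ l ∈ Finset.range m, (θ ^ l)⁻¹ * entrySum (T ^ l), Finset.sum_nonneg fun l _ =>
    mul_nonneg (by positivity) (entrySum_nonneg _), fun v => ?_⟩
  rw [adaptedNorm, Finset.sum_mul]
  refine Finset.sum_le_sum fun l _ => ?_
  rw [mul_assoc]
  exact mul_le_mul_of_nonneg_left (norm_act_le_entrySum _ v) (by positivity)

/-- A matrix of spectral radius below one contracts some norm, equivalent to the maximum norm
with constants that do not depend on the space of vectors. -/
theorem exists_contracting_norm (T : Matrix ι ι ℝ)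
    (hT : ∀ z, (complexify T).charpoly.IsRoot z → ‖z‖ < 1) :
    ∃ θ c : ℝ, 0 < θ ∧ θ < 1 ∧ 0 ≤ c ∧
      ∀ (E : Type*) [NormedAddCommGroup E] [NormedSpace ℝ E], ∃ N : (ι → E) → ℝ,
        (∀ v, ‖v‖ ≤ N v) ∧ ∀ v w, N (act T v + w) ≤ θ * N v + c * ‖w‖ := by
  obtain ⟨m, θ, hm, hθ0, hθ1, hpow⟩ := exists_pow_row_sum_le T hT
  obtain ⟨c, hc0, hc⟩ := exists_adaptedNorm_le T hθ0 m
  exact ⟨θ, c, hθ0, hθ1, hc0, fun E _ _ => ⟨adaptedNorm T θ m, norm_le_adaptedNorm hθ0 hm,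
    fun v w => (adaptedNorm_add_le hθ0 _ _).trans
      (add_le_add (adaptedNorm_act_le hθ0 hpow v) (hc w))⟩⟩

end Action

/-! ### One step of the iteration: projection, total gap, disagreement, imbalance. -/

section Step

/-- The displacement produced by projecting `v + h`, for `v` in the convex set, lies in the ball
with diameter from `0` to `h`. -/
theorem IsProjection.norm_sub_half_le {p : ℕ} {X : Set (EuclideanSpace ℝ (Fin p))}
    (hX : Convex ℝ X) {v h x : EuclideanSpace ℝ (Fin p)} (hv : v ∈ X)
    (hx : IsProjection X (v + h) x) :
    ‖(x - v) - (1 / 2 : ℝ) • h‖ ≤ 1 / 2 * ‖h‖ := by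
  set e := x - v with he
  -- Variational inequality of the projection, from comparing `x` with points of the segment towards
  -- `v`. Completing the square turns it into the ball.
  have hinner : inner ℝ (e - h) e ≤ 0 := by
    by_contra! hc
    have hmin : ∀ t : ℝ, 0 ≤ t → t ≤ 1 → 2 * t * inner ℝ (e - h) e ≤ t ^ 2 * ‖e‖ ^ 2 := by
      intro t ht0 ht1
      have hmem := hX hx.1 hv (sub_nonneg.2 ht1) ht0 (by ring)
      have h1 := hx.2 _ hmem
      have e1 : x - (v + h) = e - h := by rw [he]; abel
      have e2 : (1 - t) • x + t • v - (v + h) = (e - h) - t • e := by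
        rw [he]; module
      rw [e1, e2, norm_sub_sq_real (e - h), inner_smul_right, norm_smul, mul_pow,
        Real.norm_eq_abs, sq_abs] at h1
      linarith
    have hepos : 0 < ‖e‖ ^ 2 := by
      have h1 := hmin 1 zero_le_one le_rfl
      linarith
    set c : ℝ := inner ℝ (e - h) e
    have htpos : 0 < min 1 (c / ‖e‖ ^ 2) := by positivity
    have h1 := hmin _ htpos.le (min_le_left _ _)
    have h2 : min 1 (c / ‖e‖ ^ 2) * ‖e‖ ^ 2 ≤ c :=
      (le_div_iff₀ hepos).1 (min_le_right _ _)
    nlinarith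
  refine le_of_sq_le_sq ?_ (by positivity)
  rw [inner_sub_left, real_inner_self_eq_norm_sq] at hinner
  rw [norm_sub_sq_real, inner_smul_right, norm_smul, real_inner_comm, mul_pow, mul_pow]
  norm_num
  linarith

variable {ι : Type*} [Fintype ι] {E : Type*} [NormedAddCommGroup E] [NormedSpace ℝ E]

/-- Contraction of a vector `S` under the step `-ε S`, perturbed by a weighted sum of vectors `e i`,
each in the ball with diameter from `0` to `ε π i S + r i`. -/
theorem norm_sub_smul_add_sum_le {S : E} {r e : ι → E} {q κ : ι → ℝ} {ε μ N R : ℝ}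
    (hq : ∀ i, 0 ≤ q i) (hq1 : ∑ i, q i = 1) (hκ : ∀ i, κ i ≤ 1 - μ) (hμ : μ ≤ 1)
    (hN : ∀ i, |κ i| ≤ N) (hε : 0 ≤ ε) (hεN : ε * (1 + N) ≤ 1)
    (he : ∀ i, ‖e i - (1 / 2 : ℝ) • ((ε * q i) • S + r i)‖ ≤ 1 / 2 * ‖(ε * q i) • S + r i‖)
    (hr : ∀ i, ‖r i‖ ≤ R) :
    ‖S - ε • S + ∑ i, κ i • e i‖ ≤ (1 - μ * ε) * ‖S‖ + Fintype.card ι * (N * R) := by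
  set g : ι → E := fun i => e i - (1 / 2 : ℝ) • ((ε * q i) • S + r i) with hg
  -- The centres of the balls contribute `ε/2 * κ i * q i` to the coefficient of `S`, with sign;
  -- only the radii contribute `|κ i|`.
  have hdec : S - ε • S + ∑ i, κ i • e i =
      (1 - ε + ∑ i, ε / 2 * κ i * q i) • S + ∑ i, κ i • ((1 / 2 : ℝ) • r i + g i) := by
    have : ∀ i, κ i • e i = (ε / 2 * κ i * q i) • S + κ i • ((1 / 2 : ℝ) • r i + g i) := by
      intro i
      simp only [hg]
      module
    simp only [this, Finset.sum_add_distrib, ← Finset.sum_smul]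
    module
  have hκq : -(ε / 2 * N) ≤ ∑ i, ε / 2 * κ i * q i := by
    calc -(ε / 2 * N) = ∑ i, ε / 2 * (-N) * q i := by
          rw [← Finset.mul_sum, hq1]; ring
      _ ≤ _ := Finset.sum_le_sum fun i _ => mul_le_mul_of_nonneg_right
          (mul_le_mul_of_nonneg_left (abs_le.1 (hN i)).1 (by positivity)) (hq i)
  have hcoef : 0 ≤ 1 - ε + ∑ i, ε / 2 * κ i * q i := by
    rcases isEmpty_or_nonempty ι with h | ⟨⟨i⟩⟩
    · simp at hq1
    · have : 0 ≤ N := (abs_nonneg _).trans (hN i)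
      nlinarith
  have hterm : ∀ i, ‖κ i • ((1 / 2 : ℝ) • r i + g i)‖ ≤
      ε / 2 * |κ i| * q i * ‖S‖ + N * R := by
    intro i
    have h1 : ‖(ε * q i) • S + r i‖ ≤ ε * q i * ‖S‖ + R := by
      refine (norm_add_le _ _).trans (add_le_add ?_ (hr i))
      rw [norm_smul, Real.norm_of_nonneg (mul_nonneg hε (hq i))]
    have h2 : ‖(1 / 2 : ℝ) • r i‖ ≤ 1 / 2 * R := by
      rw [norm_smul, Real.norm_of_nonneg (by norm_num)]
      exact mul_le_mul_of_nonneg_left (hr i) (by norm_num)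
    have h3 := he i
    have hR : 0 ≤ R := (norm_nonneg _).trans (hr i)
    rw [norm_smul, Real.norm_eq_abs]
    calc |κ i| * ‖(1 / 2 : ℝ) • r i + g i‖
        ≤ |κ i| * (1 / 2 * R + 1 / 2 * (ε * q i * ‖S‖ + R)) := by
          refine mul_le_mul_of_nonneg_left ((norm_add_le _ _).trans (add_le_add h2 ?_))
            (abs_nonneg _)
          exact h3.trans (mul_le_mul_of_nonneg_left h1 (by norm_num))
      _ = ε / 2 * |κ i| * q i * ‖S‖ + |κ i| * R := by ring
      _ ≤ _ := add_le_add le_rfl (mul_le_mul_of_nonneg_right (hN i) hR)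
  have hpos : ∑ i, (ε / 2 * κ i * q i + ε / 2 * |κ i| * q i) ≤ ε * (1 - μ) := by
    calc _ ≤ ∑ i, ε * (1 - μ) * q i := by
          refine Finset.sum_le_sum fun i _ => ?_
          -- Centre and radius cancel for negative `κ i`, however large `|κ i|` is. The bound `‖e i‖
          -- ≤ ‖(ε * q i) • S + r i‖` alone would lose this cancellation.
          have h1 : κ i + |κ i| ≤ 2 * (1 - μ) := by
            rcases abs_cases (κ i) with ⟨h, _⟩ | ⟨h, _⟩
            · linarith [hκ i]
            · linarith
          have := mul_le_mul_of_nonneg_left h1 (mul_nonneg hε (hq i))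
          linarith
      _ = _ := by rw [← Finset.mul_sum, hq1, mul_one]
  rw [Finset.sum_add_distrib] at hpos
  have hsum : ∑ i, ‖κ i • ((1 / 2 : ℝ) • r i + g i)‖ ≤
      (∑ i, ε / 2 * |κ i| * q i) * ‖S‖ + Fintype.card ι * (N * R) := by
    refine (Finset.sum_le_sum fun i _ => hterm i).trans_eq ?_
    rw [Finset.sum_add_distrib, ← Finset.sum_mul, Finset.sum_const, nsmul_eq_mul, Finset.card_univ]
  rw [hdec]
  refine (norm_add_le _ _).trans ?_
  rw [norm_smul, Real.norm_of_nonneg hcoef]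
  have h1 := norm_sum_le Finset.univ fun i => κ i • ((1 / 2 : ℝ) • r i + g i)
  have h2 := mul_le_mul_of_nonneg_right hpos (norm_nonneg S)
  linarith

variable {a b : Matrix ι ι ℝ} {w q : ι → ℝ}

/-- The total of all states, relative to the `w`-average of the estimates. -/
noncomputable def totalGap (w : ι → ℝ) (x y : ι → E) : E :=
  ∑ i, x i + ∑ i, y i - (Fintype.card ι : ℝ) • ∑ i, w i • x i

/-- `a` preserves the `w`-average, `b` preserves sums, and what the estimates gain from mixing the
surpluses lose. Only the drain `ε y` and the displacements remain. -/
theorem totalGap_step (hb : ∀ j, ∑ i, b i j = 1) (hwa : w ᵥ* a = w) (x y e : ι → E) (ε : ℝ) :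
    totalGap w (act a x + e) (x - act a x + act b y - ε • y) =
      totalGap w x y - ε • ∑ i, y i + ∑ i, (1 - Fintype.card ι * w i) • e i := by
  have hwa' : ∀ j, ∑ i, w i * a i j = w j := congrFun hwa
  have h1 : ∑ i, w i • act a x i = ∑ i, w i • x i := by
    simp only [act_apply, Finset.smul_sum, ← mul_smul]
    rw [Finset.sum_comm]
    simp only [← Finset.sum_smul, hwa']
  have h2 : ∑ i, act b y i = ∑ i, y i := by
    simp only [act_apply]
    rw [Finset.sum_comm]
    simp only [← Finset.sum_smul, hb, one_smul]
  simp only [totalGap, Pi.add_apply, Pi.sub_apply, Pi.smul_apply, smul_add, Finset.sum_add_distrib,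
    Finset.sum_sub_distrib, h1, h2, sub_smul, one_smul, mul_smul, ← Finset.smul_sum]
  abel

variable [DecidableEq ι]

/-- The deviation of the estimates from their `w`-average. -/
noncomputable def disagreement (w : ι → ℝ) (x : ι → E) : ι → E :=
  act (1 - Matrix.of fun _ j => w j) x

/-- The deviation of the surpluses from the distribution `q` of their sum. -/
noncomputable def imbalance (q : ι → ℝ) (y : ι → E) : ι → E :=
  act (1 - Matrix.of fun i _ => q i) y

theorem disagreement_apply (w : ι → ℝ) (x : ι → E) (i : ι) :
    disagreement w x i = x i - ∑ j, w j • x j := by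
  rw [disagreement, act_sub, act_one]
  simp [act_apply]

theorem imbalance_apply (q : ι → ℝ) (y : ι → E) (i : ι) :
    imbalance q y i = y i - q i • ∑ j, y j := by
  rw [imbalance, act_sub, act_one]
  simp [act_apply, Finset.smul_sum]

/-- The projection `W = 1wᵀ` satisfies `aW = Wa = W`, whence `(1 - W)a = (a - W)(1 - W)`. -/
theorem disagreement_act_add (ha : ∀ i, ∑ j, a i j = 1) (hw1 : ∑ i, w i = 1) (hwa : w ᵥ* a = w)
    (x e : ι → E) :
    disagreement w (act a x + e) =
      act (a - Matrix.of fun _ j => w j) (disagreement w x) + disagreement w e := by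
  have hwa' : ∀ j, ∑ i, w i * a i j = w j := congrFun hwa
  have key : (1 - Matrix.of fun _ j => w j) * a =
      (a - Matrix.of fun _ j => w j) * (1 - Matrix.of fun _ j => w j) := by
    have h1 : (Matrix.of fun (_ : ι) j => w j) * a = Matrix.of fun _ j => w j := by
      ext i j
      simp [Matrix.mul_apply, hwa']
    have h2 : a * (Matrix.of fun (_ : ι) j => w j) = Matrix.of fun _ j => w j := by
      ext i j
      simp [Matrix.mul_apply, ← Finset.sum_mul, ha]
    have h3 : (Matrix.of fun (_ : ι) j => w j) * (Matrix.of fun (_ : ι) j => w j) =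
        Matrix.of fun _ j => w j := by
      ext i j
      simp [Matrix.mul_apply, ← Finset.sum_mul, hw1]
    rw [sub_mul, mul_sub, sub_mul, sub_mul, h1, h2, h3, one_mul, mul_one, mul_one]
    abel
  rw [disagreement, map_add, ← act_mul, key, act_mul]
  rfl

theorem imbalance_step (ha : ∀ i, ∑ j, a i j = 1) (hb : ∀ j, ∑ i, b i j = 1)
    (hq1 : ∑ i, q i = 1) (hqb : b *ᵥ q = q) (x y z : ι → E) :
    imbalance q (x - act a x + act b y - z) =
      act (b - Matrix.of fun i _ => q i) (imbalance q y) +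
        imbalance q (act (1 - a) (disagreement w x) - z) := by
  have hqb' : ∀ i, ∑ j, b i j * q j = q i := congrFun hqb
  have key : (1 - Matrix.of fun i _ => q i) * b =
      (b - Matrix.of fun i _ => q i) * (1 - Matrix.of fun i _ => q i) := by
    have h1 : (Matrix.of fun i (_ : ι) => q i) * b = Matrix.of fun i _ => q i := by
      ext i j
      simp [Matrix.mul_apply, ← Finset.mul_sum, hb]
    have h2 : b * (Matrix.of fun i (_ : ι) => q i) = Matrix.of fun i _ => q i := by
      ext i j
      simp [Matrix.mul_apply, hqb']
    have h3 : (Matrix.of fun i (_ : ι) => q i) * (Matrix.of fun i (_ : ι) => q i) =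
        Matrix.of fun i _ => q i := by
      ext i j
      simp [Matrix.mul_apply, ← Finset.mul_sum, hq1]
    rw [sub_mul, mul_sub, sub_mul, sub_mul, h1, h2, h3, one_mul, mul_one, mul_one]
    abel
  -- `1 - a` annihilates constant families, so the estimates feed the surpluses through their
  -- disagreement only.
  have key₂ : (1 - a) * (1 - Matrix.of fun _ j => w j) = 1 - a := by
    have h2 : a * (Matrix.of fun (_ : ι) j => w j) = Matrix.of fun _ j => w j := by
      ext i j
      simp [Matrix.mul_apply, ← Finset.sum_mul, ha]
    rw [sub_mul, mul_sub, mul_sub, h2, one_mul, mul_one, one_mul]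
    abel
  have h1 : x - act a x = act (1 - a) (disagreement w x) := by
    rw [disagreement, ← act_mul, key₂, act_sub, act_one]
  have h2 : x - act a x + act b y - z =
      act b y + (act (1 - a) (disagreement w x) - z) := by
    rw [h1]; abel
  rw [h2, imbalance, map_add, ← act_mul, key, act_mul]
  rfl

theorem totalGap_eq (w : ι → ℝ) (x y : ι → E) :
    totalGap w x y = ∑ i, y i + ∑ i, disagreement w x i := by
  simp only [totalGap, disagreement_apply, Finset.sum_sub_distrib, Finset.sum_const,
    Finset.card_univ, Nat.cast_smul_eq_nsmul]
  abel

end Step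

/-! ### Norm bounds in terms of the three errors. -/

section Estimates

variable {ι : Type*} [Fintype ι]

theorem norm_sum_le_card_mul {E : Type*} [NormedAddCommGroup E] (v : ι → E) : ‖∑ i, v i‖ ≤ Fintype.card ι * ‖v‖ := by
  refine (norm_sum_le _ _).trans ((Finset.sum_le_sum fun i _ => norm_le_pi_norm v i).trans_eq ?_)
  rw [Finset.sum_const, nsmul_eq_mul, Finset.card_univ]

variable {E : Type*} [NormedAddCommGroup E] [NormedSpace ℝ E]

theorem norm_displacement_le {y r e : ι → E} {ε ρ : ℝ} (hε : 0 ≤ ε) (hρ : 0 ≤ ρ)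
    (he : ∀ i, ‖e i - (1 / 2 : ℝ) • (ε • y i + r i)‖ ≤ 1 / 2 * ‖ε • y i + r i‖)
    (hr : ∀ i, ‖r i‖ ≤ ρ) : ‖e‖ ≤ ε * ‖y‖ + ρ := by
  refine (pi_norm_le_iff_of_nonneg (by positivity)).2 fun i => ?_
  have h1 : ‖ε • y i + r i‖ ≤ ε * ‖y‖ + ρ := by
    refine (norm_add_le _ _).trans (add_le_add ?_ (hr i))
    rw [norm_smul, Real.norm_of_nonneg hε]
    exact mul_le_mul_of_nonneg_left (norm_le_pi_norm y i) hε
  have h2 := norm_le_norm_sub_add (e i) ((1 / 2 : ℝ) • (ε • y i + r i))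
  rw [norm_smul, Real.norm_of_nonneg (by norm_num)] at h2
  linarith [he i]

variable [DecidableEq ι] {a b : Matrix ι ι ℝ} {w q : ι → ℝ}

theorem norm_sum_surplus_le (w : ι → ℝ) (x y : ι → E) :
    ‖∑ i, y i‖ ≤ ‖totalGap w x y‖ + Fintype.card ι * ‖disagreement w x‖ := by
  rw [eq_sub_of_add_eq (totalGap_eq w x y).symm]
  exact (norm_sub_le _ _).trans (add_le_add le_rfl (norm_sum_le_card_mul _))

theorem norm_surplus_le (hq0 : ∀ i, 0 ≤ q i) (hq1 : ∑ i, q i = 1) (w : ι → ℝ) (x y : ι → E) :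
    ‖y‖ ≤ ‖totalGap w x y‖ + Fintype.card ι * ‖disagreement w x‖ + ‖imbalance q y‖ := by
  refine (pi_norm_le_iff_of_nonneg (by positivity)).2 fun i => ?_
  have hqi : q i ≤ 1 := hq1 ▸ Finset.single_le_sum (fun j _ => hq0 j) (Finset.mem_univ i)
  have hy : y i = q i • ∑ j, y j + imbalance q y i := by
    rw [imbalance_apply]; abel
  rw [hy]
  refine (norm_add_le _ _).trans (add_le_add ?_ (norm_le_pi_norm _ i))
  rw [norm_smul, Real.norm_of_nonneg (hq0 i)]
  exact (mul_le_of_le_one_left (norm_nonneg _) hqi).trans (norm_sum_surplus_le w x y)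

theorem norm_totalGap_step_le (hb : ∀ j, ∑ i, b i j = 1) (hwa : w ᵥ* a = w)
    (hw0 : ∀ i, 0 ≤ w i) (hw1 : ∑ i, w i = 1) (hq0 : ∀ i, 0 ≤ q i) (hq1 : ∑ i, q i = 1)
    {μ ε ρ : ℝ} (hμ1 : μ ≤ 1) (hμ : ∀ i, μ ≤ Fintype.card ι * w i) (hε : 0 ≤ ε)
    (hε1 : ε * (1 + Fintype.card ι) ≤ 1) (x : ι → E) {y r e : ι → E}
    (he : ∀ i, ‖e i - (1 / 2 : ℝ) • (ε • y i + r i)‖ ≤ 1 / 2 * ‖ε • y i + r i‖)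
    (hr : ∀ i, ‖r i‖ ≤ ρ) :
    ‖totalGap w (act a x + e) (x - act a x + act b y - ε • y)‖ ≤
      (1 - μ * ε) * ‖totalGap w x y‖ + ε * (Fintype.card ι * ‖disagreement w x‖) +
        Fintype.card ι * (Fintype.card ι *
          (ε * (Fintype.card ι * ‖disagreement w x‖) + ε * ‖imbalance q y‖ + ρ)) := by
  set c : ℝ := (Fintype.card ι : ℝ) with hc
  set S := totalGap w x y with hS
  set D := ∑ i, disagreement w x i with hD
  have hDn : ‖D‖ ≤ c * ‖disagreement w x‖ := norm_sum_le_card_mul _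
  have hs : ∑ i, y i = S - D := eq_sub_of_add_eq (totalGap_eq w x y).symm
  have hw_le : ∀ i, w i ≤ 1 := fun i =>
    hw1 ▸ Finset.single_le_sum (fun j _ => hw0 j) (Finset.mem_univ i)
  have hq_le : ∀ i, q i ≤ 1 := fun i =>
    hq1 ▸ Finset.single_le_sum (fun j _ => hq0 j) (Finset.mem_univ i)
  have hN : ∀ i, |1 - c * w i| ≤ c := by
    intro i
    have hc1 : 1 ≤ c := by
      have : 0 < Fintype.card ι := Fintype.card_pos_iff.2 ⟨i⟩
      rw [hc]
      exact_mod_cast this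
    have h1 : c * w i ≤ c * 1 := mul_le_mul_of_nonneg_left (hw_le i) (by positivity)
    have h2 : 0 ≤ c * w i := mul_nonneg (by positivity) (hw0 i)
    rw [abs_le]
    constructor <;> linarith
  -- The surplus is `q i • (S - D)` plus the imbalance; everything but `(ε * q i) • S` goes into the
  -- remainder.
  have hy : ∀ i, ε • y i + r i =
      (ε * q i) • S + (-((ε * q i) • D) + ε • imbalance q y i + r i) := by
    intro i
    rw [imbalance_apply, hs]
    module
  have hmain := norm_sub_smul_add_sum_le (S := S) (e := e) (κ := fun i => 1 - c * w i)
    (r := fun i => -((ε * q i) • D) + ε • imbalance q y i + r i)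
    (R := ε * (c * ‖disagreement w x‖) + ε * ‖imbalance q y‖ + ρ)
    hq0 hq1 (fun i => by linarith [hμ i]) hμ1 hN hε hε1
    (fun i => by simpa only [hy i] using he i) (fun i => by
      refine (norm_add_le _ _).trans (add_le_add ((norm_add_le _ _).trans (add_le_add ?_ ?_))
        (hr i))
      · rw [norm_neg, norm_smul, Real.norm_of_nonneg (mul_nonneg hε (hq0 i)), mul_assoc]
        refine mul_le_mul_of_nonneg_left ?_ hε
        exact (mul_le_of_le_one_left (norm_nonneg _) (hq_le i)).trans hDn
      · rw [norm_smul, Real.norm_of_nonneg hε]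
        exact mul_le_mul_of_nonneg_left (norm_le_pi_norm _ i) hε)
  rw [totalGap_step hb hwa, hs]
  have hre : S - ε • (S - D) + ∑ i, (1 - c * w i) • e i =
      (S - ε • S + ∑ i, (1 - c * w i) • e i) + ε • D := by
    module
  rw [hre]
  refine (norm_add_le _ _).trans ?_
  have h3 : ‖ε • D‖ ≤ ε * (c * ‖disagreement w x‖) := by
    rw [norm_smul, Real.norm_of_nonneg hε]
    exact mul_le_mul_of_nonneg_left hDn hε
  linarith

end Estimates

/-! ### Convergence of the errors along a run. -/

section Run

variable {n p : ℕ} {a b : Matrix (Fin n) (Fin n) ℝ} {w q : Fin n → ℝ} {ε : ℝ} {α : ℕ → ℝ}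
  {f : Fin n → EuclideanSpace ℝ (Fin p) → ℝ} {X : Set (EuclideanSpace ℝ (Fin p))}
  {x y d : ℕ → Fin n → EuclideanSpace ℝ (Fin p)}

theorem IsStepSize.tendsto_zero (hα : IsStepSize α) : Tendsto α atTop (𝓝 0) := by
  have h := (hα.summable_sq.tendsto_atTop_zero).sqrt
  simpa [Real.sqrt_sq (hα.nonneg _)] using h

theorem IsRun.y_succ_eq (h : IsRun a b ε α f X x y d) (k : ℕ) :
    y (k + 1) = x k - act a (x k) + act b (y k) - ε • y k :=
  funext fun i => h.y_succ k i

/-- After the first step all estimates lie in the convex set, so the displacement of each estimate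
lies in a ball determined by the step before projection. -/
theorem IsRun.norm_displacement_sub_half_le (h : IsRun a b ε α f X x y d) (hX : Convex ℝ X)
    (ha0 : ∀ i j, 0 ≤ a i j) (ha1 : ∀ i, ∑ j, a i j = 1) (k : ℕ) (i : Fin n) :
    ‖(x (k + 2) - act a (x (k + 1))) i -
        (1 / 2 : ℝ) • (ε • y (k + 1) i + -(α (k + 1) • d (k + 1) i))‖ ≤
      1 / 2 * ‖ε • y (k + 1) i + -(α (k + 1) • d (k + 1) i)‖ := by
  have hv : act a (x (k + 1)) i ∈ X :=
    hX.sum_mem (fun j _ => ha0 i j) (ha1 i) fun j _ => (h.x_succ k j).1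
  refine IsProjection.norm_sub_half_le hX hv ?_
  rw [← sub_eq_add_neg, ← add_sub_assoc]
  exact h.x_succ (k + 1) i

/-- The errors of a run vanish, for `ε` below a threshold that depends on the weights only. -/
theorem exists_threshold_errors_tendsto_zero [Nonempty (Fin n)]
    (ha0 : ∀ i j, 0 ≤ a i j) (ha1 : ∀ i, ∑ j, a i j = 1)
    (hb : ∀ j, ∑ i, b i j = 1) (hw0 : ∀ i, 0 < w i) (hw1 : ∑ i, w i = 1) (hwa : w ᵥ* a = w)
    (hq0 : ∀ i, 0 ≤ q i) (hq1 : ∑ i, q i = 1) (hqb : b *ᵥ q = q)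
    (hspa : ∀ z, (complexify (a - Matrix.of fun _ j => w j)).charpoly.IsRoot z → ‖z‖ < 1)
    (hspb : ∀ z, (complexify (b - Matrix.of fun i _ => q i)).charpoly.IsRoot z → ‖z‖ < 1) :
    ∃ ε₀ : ℝ, 0 < ε₀ ∧ ∀ ε : ℝ, 0 < ε → ε ≤ ε₀ →
      ∀ {p : ℕ} {X : Set (EuclideanSpace ℝ (Fin p))}, Convex ℝ X →
      ∀ {f : Fin n → EuclideanSpace ℝ (Fin p) → ℝ} {D : ℝ} {α : ℕ → ℝ}
        {x y d : ℕ → Fin n → EuclideanSpace ℝ (Fin p)}, IsRun a b ε α f X x y d →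
      (∀ k, 0 ≤ α k) → Tendsto α atTop (𝓝 0) → (∀ k i, ‖d k i‖ ≤ D) →
      Tendsto (fun k => ‖totalGap w (x k) (y k)‖) atTop (𝓝 0) ∧
        Tendsto (fun k => ‖disagreement w (x k)‖) atTop (𝓝 0) ∧
        Tendsto (fun k => ‖imbalance q (y k)‖) atTop (𝓝 0) := by
  obtain ⟨θa, ca, hθa0, hθa1, hca, hNa⟩ := exists_contracting_norm _ hspa
  obtain ⟨θb, cb, hθb0, hθb1, hcb, hNb⟩ := exists_contracting_norm _ hspb
  obtain ⟨m, hm⟩ := Finite.exists_min w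
  set c : ℝ := (Fintype.card (Fin n) : ℝ) with hc
  have hc0 : 0 < c := by
    rw [hc]; exact_mod_cast Fintype.card_pos
  set E₁ := entrySum (1 - Matrix.of fun (_ : Fin n) j => w j) with hE₁
  set E₂ := entrySum (1 - Matrix.of fun i (_ : Fin n) => q i) with hE₂
  set E₃ := entrySum (1 - a) with hE₃
  have hE₁0 : 0 ≤ E₁ := entrySum_nonneg _
  have hE₂0 : 0 ≤ E₂ := entrySum_nonneg _
  have hE₃0 : 0 ≤ E₃ := entrySum_nonneg _
  set C₁ : ℝ := c + c * c * (1 + c) with hC₁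
  set C₂ : ℝ := ca * E₁ * (1 + c) with hC₂
  set C₃ : ℝ := cb * E₂ * (E₃ + 1 + c) with hC₃
  have hC₁0 : 0 ≤ C₁ := by positivity
  have hC₂0 : 0 ≤ C₂ := by positivity
  have hC₃0 : 0 ≤ C₃ := by positivity
  -- The decay rate `μ` of the total gap: positivity of the smallest stationary weight keeps every
  -- `1 - c * w i` at most `1 - μ`.
  have hμ0 : 0 < min 1 (c * w m) := lt_min one_pos (mul_pos hc0 (hw0 m))
  obtain ⟨ε₁, hε₁, hthr⟩ := exists_threshold_tendsto_zero hμ0 (hθa0.le.trans (le_max_left θa θb))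
    (max_lt hθa1 hθb1) (add_nonneg (add_nonneg hC₁0 hC₂0) hC₃0)
  refine ⟨min ε₁ (1 / (1 + c)), by positivity,
    fun ε hε hεle p X hX f D α x y d hrun hα0 hα hd => ?_⟩
  have hε1 : ε * (1 + c) ≤ 1 := (le_div_iff₀ (by positivity)).1 (hεle.trans (min_le_right _ _))
  obtain ⟨Na, hNa1, hNa2⟩ := hNa (EuclideanSpace ℝ (Fin p))
  obtain ⟨Nb, hNb1, hNb2⟩ := hNb (EuclideanSpace ℝ (Fin p))
  have hD0 : 0 ≤ D := (norm_nonneg _).trans (hd 0 m)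
  have hr : ∀ k i, ‖-(α k • d k i)‖ ≤ α k * D := by
    intro k i
    rw [norm_neg, norm_smul, Real.norm_of_nonneg (hα0 k)]
    exact mul_le_mul_of_nonneg_left (hd k i) (hα0 k)
  -- All sequences start at time 1: the initial estimates need not lie in `X`, and the ball bound
  -- needs their averages in `X`.
  set e : ℕ → Fin n → EuclideanSpace ℝ (Fin p) :=
    fun k => x (k + 2) - act a (x (k + 1)) with he_def
  have hx : ∀ k, x (k + 2) = act a (x (k + 1)) + e k := fun k =>
    (add_sub_cancel _ _).symm
  have he : ∀ k i, ‖e k i - (1 / 2 : ℝ) • (ε • y (k + 1) i + -(α (k + 1) • d (k + 1) i))‖ ≤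
      1 / 2 * ‖ε • y (k + 1) i + -(α (k + 1) • d (k + 1) i)‖ :=
    hrun.norm_displacement_sub_half_le hX ha0 ha1
  set s : ℕ → ℝ := fun k => ‖totalGap w (x (k + 1)) (y (k + 1))‖ with hs
  set u : ℕ → ℝ := fun k => Na (disagreement w (x (k + 1))) with hu
  set v : ℕ → ℝ := fun k => Nb (imbalance q (y (k + 1))) with hv
  have hs0 : ∀ k, 0 ≤ s k := fun k => norm_nonneg _
  have hu0 : ∀ k, 0 ≤ u k := fun k => (norm_nonneg _).trans (hNa1 _)
  have hv0 : ∀ k, 0 ≤ v k := fun k => (norm_nonneg _).trans (hNb1 _)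
  have hyn : ∀ k, ‖y (k + 1)‖ ≤ s k + c * u k + v k := fun k =>
    (norm_surplus_le hq0 hq1 w _ _).trans (add_le_add (add_le_add le_rfl
      (mul_le_mul_of_nonneg_left (hNa1 _) hc0.le)) (hNb1 _))
  have hyn' : ∀ k, ‖y (k + 1)‖ ≤ (1 + c) * (s k + u k + v k) := by
    intro k
    have := mul_nonneg hc0.le (hs0 k)
    have := mul_nonneg hc0.le (hv0 k)
    linarith [hyn k, hu0 k]
  have hen : ∀ k, ‖e k‖ ≤ ε * ‖y (k + 1)‖ + α (k + 1) * D := fun k =>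
    norm_displacement_le hε.le (mul_nonneg (hα0 _) hD0) (he k) (hr _)
  set τ : ℕ → ℝ := fun k => (c * c + ca * E₁) * D * α (k + 1) with hτ
  have hτ0 : Tendsto τ atTop (𝓝 0) := by
    simpa using (hα.comp (tendsto_add_atTop_nat 1)).const_mul ((c * c + ca * E₁) * D)
  have hsum0 : ∀ k, 0 ≤ s k + u k + v k := fun k =>
    add_nonneg (add_nonneg (hs0 k) (hu0 k)) (hv0 k)
  have hαD : ∀ k, 0 ≤ α k * D := fun k => mul_nonneg (hα0 k) hD0
  have step_s : ∀ k, s (k + 1) ≤ (1 - min 1 (c * w m) * ε) * s k +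
      (C₁ + C₂ + C₃) * ε * (u k + v k) + τ k := by
    intro k
    have h1 := norm_totalGap_step_le hb hwa (fun i => (hw0 i).le) hw1 hq0 hq1
      (min_le_left 1 (c * w m))
      (fun i => (min_le_right _ _).trans (mul_le_mul_of_nonneg_left (hm i) hc0.le))
      hε.le hε1 (x (k + 1)) (he k) (hr (k + 1))
    rw [← hx, ← hrun.y_succ_eq] at h1
    have hdu : ‖disagreement w (x (k + 1))‖ ≤ u k := hNa1 _
    have hdv : ‖imbalance q (y (k + 1))‖ ≤ v k := hNb1 _
    have g1 : ε * (c * ‖disagreement w (x (k + 1))‖) ≤ ε * (c * u k) := by gcongr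
    have g2 : c * (c * (ε * (c * ‖disagreement w (x (k + 1))‖) +
        ε * ‖imbalance q (y (k + 1))‖ + α (k + 1) * D)) ≤
        c * (c * (ε * (c * u k) + ε * v k + α (k + 1) * D)) := by gcongr
    have g3 : ε * (c * u k) + c * (c * (ε * (c * u k) + ε * v k)) ≤ C₁ * ε * (u k + v k) := by
      have := mul_nonneg (mul_nonneg hε.le hc0.le) (hv0 k)
      have := mul_nonneg (mul_nonneg hε.le (mul_pos hc0 hc0).le) (hu0 k)
      have := mul_nonneg (mul_nonneg hε.le (mul_pos hc0 (mul_pos hc0 hc0)).le) (hv0 k)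
      rw [hC₁]
      linarith
    have g4 : 0 ≤ (C₂ + C₃) * ε * (u k + v k) :=
      mul_nonneg (by positivity) (add_nonneg (hu0 k) (hv0 k))
    have g5 : 0 ≤ ca * E₁ * (α (k + 1) * D) := mul_nonneg (by positivity) (hαD _)
    have h2 : s (k + 1) ≤ (1 - min 1 (c * w m) * ε) * s k +
      ε * (c * ‖disagreement w (x (k + 1))‖) + c * (c * (ε * (c * ‖disagreement w (x (k + 1))‖) +
        ε * ‖imbalance q (y (k + 1))‖ + α (k + 1) * D)) := h1
    simp only [hτ]
    linarith
  have step_u : ∀ k, u (k + 1) ≤ max θa θb * u k +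
      (C₁ + C₂ + C₃) * ε * (s k + u k + v k) + τ k := by
    intro k
    have h1 : u (k + 1) ≤ θa * u k + ca * ‖disagreement w (e k)‖ := by
      simp only [hu]
      rw [show k + 1 + 1 = k + 2 from rfl, hx, disagreement_act_add ha1 hw1 hwa]
      exact hNa2 _ _
    have h2 : ‖disagreement w (e k)‖ ≤ E₁ * ‖e k‖ := norm_act_le_entrySum _ _
    have h3 : ‖e k‖ ≤ ε * ((1 + c) * (s k + u k + v k)) + α (k + 1) * D :=
      (hen k).trans (add_le_add (mul_le_mul_of_nonneg_left (hyn' k) hε.le) le_rfl)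
    have h4 : ca * ‖disagreement w (e k)‖ ≤
        ca * (E₁ * (ε * ((1 + c) * (s k + u k + v k)) + α (k + 1) * D)) :=
      mul_le_mul_of_nonneg_left (h2.trans (mul_le_mul_of_nonneg_left h3 hE₁0)) hca
    have g1 := mul_le_mul_of_nonneg_right (le_max_left θa θb) (hu0 k)
    have g4 : 0 ≤ (C₁ + C₃) * ε * (s k + u k + v k) := mul_nonneg (by positivity) (hsum0 k)
    have g5 : 0 ≤ c * c * (α (k + 1) * D) := mul_nonneg (by positivity) (hαD _)
    simp only [hτ]
    rw [hC₂]
    linarith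
  have step_v : ∀ k, v (k + 1) ≤ max θa θb * v k + (C₁ + C₂ + C₃) * u k +
      (C₁ + C₂ + C₃) * ε * (s k + u k + v k) + τ k := by
    intro k
    have h1 : v (k + 1) ≤ θb * v k + cb *
        ‖imbalance q (act (1 - a) (disagreement w (x (k + 1))) - ε • y (k + 1))‖ := by
      simp only [hv]
      rw [hrun.y_succ_eq, imbalance_step ha1 hb hq1 hqb]
      exact hNb2 _ _
    have h2 : ‖imbalance q (act (1 - a) (disagreement w (x (k + 1))) - ε • y (k + 1))‖ ≤
        E₂ * (E₃ * u k + ε * ((1 + c) * (s k + u k + v k))) := by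
      refine (norm_act_le_entrySum _ _).trans (mul_le_mul_of_nonneg_left ?_ hE₂0)
      refine (norm_sub_le _ _).trans (add_le_add ?_ ?_)
      · exact (norm_act_le_entrySum _ _).trans (mul_le_mul_of_nonneg_left (hNa1 _) hE₃0)
      · rw [norm_smul, Real.norm_of_nonneg hε.le]
        exact mul_le_mul_of_nonneg_left (hyn' k) hε.le
    have h3 := mul_le_mul_of_nonneg_left h2 hcb
    have g1 := mul_le_mul_of_nonneg_right (le_max_right θa θb) (hv0 k)
    have g2 : 0 ≤ (C₁ + C₂) * u k := mul_nonneg (by positivity) (hu0 k)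
    have g3 : 0 ≤ cb * E₂ * (1 + c) * u k := mul_nonneg (by positivity) (hu0 k)
    have g4 : 0 ≤ (C₁ + C₂ + cb * E₂ * E₃) * ε * (s k + u k + v k) :=
      mul_nonneg (by positivity) (hsum0 k)
    have g5 : 0 ≤ τ k := by
      have := hα0 (k + 1)
      simp only [hτ]
      positivity
    rw [hC₃]
    linarith
  obtain ⟨ts, tu, tv⟩ := hthr ε hε (hεle.trans (min_le_left _ _)) s u v τ hs0 hu0 hv0 hτ0
    step_s step_u step_v
  refine ⟨(tendsto_add_atTop_iff_nat 1).1 ts, (tendsto_add_atTop_iff_nat 1).1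
    (squeeze_zero (fun k => norm_nonneg _) (fun k => hNa1 _) tu),
    (tendsto_add_atTop_iff_nat 1).1
    (squeeze_zero (fun k => norm_nonneg _) (fun k => hNb1 _) tv)⟩

/-- The total gap is `n` times the difference between `z̄` and the `w`-average of the estimates. -/
theorem sub_accumulationState [Nonempty (Fin n)] (w : Fin n → ℝ)
    (x y : ℕ → Fin n → EuclideanSpace ℝ (Fin p)) (k : ℕ) (i : Fin n) :
    x k i - accumulationState x y k =
      disagreement w (x k) i - (1 / (n : ℝ)) • totalGap w (x k) (y k) := by
  have hn : (n : ℝ) ≠ 0 := by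
    have h := Fintype.card_pos (α := Fin n)
    rw [Fintype.card_fin] at h
    exact_mod_cast h.ne'
  rw [disagreement_apply, totalGap, accumulationState, Fintype.sum_sum_type, Fintype.card_fin,
    smul_sub, ← mul_smul, one_div, inv_mul_cancel₀ hn, one_smul]
  simp only [stackedState, Sum.elim_inl, Sum.elim_inr]
  abel

end Run

end DDPS

/-! ### The convergence theorem. -/

theorem lemma6 {n : ℕ} (G : Digraph (Fin n)) (hG : DDPS.StronglyConnected G)
    (a b : Matrix (Fin n) (Fin n) ℝ)
    (ha : DDPS.IsInWeight G a) (hb : DDPS.IsOutWeight G b) :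
    -- the smallness threshold depends only on the network and its weights
    ∃ ε₀ : ℝ, 0 < ε₀ ∧ ∀ ε : ℝ, 0 < ε → ε < DDPS.upsilon a b → ε ≤ ε₀ →
      ∀ (p : ℕ) (X : Set (EuclideanSpace ℝ (Fin p))), Convex ℝ X → IsClosed X →
      ∀ (f : Fin n → EuclideanSpace ℝ (Fin p) → ℝ) (Bf : Fin n → ℝ),
        (∀ i, ConvexOn ℝ Set.univ (f i)) →
        (∀ i v d, DDPS.IsSubgradient (f i) v d → ‖d‖ ≤ Bf i) →
      ∀ α : ℕ → ℝ, DDPS.IsStepSize α →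
      ∀ x y d : ℕ → Fin n → EuclideanSpace ℝ (Fin p), DDPS.IsRun a b ε α f X x y d →
      ∀ i : Fin n,
        Tendsto (fun k => ‖x k i - DDPS.accumulationState x y k‖) atTop (𝓝 0) ∧
        Tendsto (fun k => ‖y k i‖) atTop (𝓝 0) := by
  rcases isEmpty_or_nonempty (Fin n) with hn | hn
  · exact ⟨1, one_pos, fun _ _ _ _ _ _ _ _ _ _ _ _ _ _ _ _ _ _ i => hn.elim i⟩
  -- The condition `ε < Υ` enters through the positivity of `Υ`, which yields the spectral gap;
  -- otherwise no `ε` is admissible.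
  by_cases hU : 0 < DDPS.upsilon a b
  swap
  · exact ⟨1, one_pos, fun ε h1 h2 => absurd (h1.trans h2) hU⟩
  have : NeZero n := ⟨by
    rintro rfl
    exact hn.elim fun i => i.elim0⟩
  have hA := ha.isIrreducibleStochastic hG
  have hB := hb.isIrreducibleStochastic_transpose hG
  obtain ⟨hgapA, hgapB⟩ :=
    DDPS.norm_lt_one_of_isRoot_charpoly hA hB (DDPS.lambda3Modulus_lt_one hA hB hU)
  obtain ⟨w, hw0, hw1, hwa⟩ := hA.exists_stationary
  obtain ⟨q, hq0, hq1, hqb⟩ := hB.exists_stationary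
  obtain ⟨ε₀, hε₀, h⟩ := DDPS.exists_threshold_errors_tendsto_zero hA.nonneg ha.row_sum hb.col_sum
    hw0 hw1 hwa (fun i => (hq0 i).le) hq1 ((Matrix.vecMul_transpose b q).symm.trans hqb)
    (fun z => hA.norm_lt_one_of_isRoot_sub hw1 hwa hgapA)
    -- `b - q1ᵀ` is the transpose of `bᵀ - 1qᵀ`, to which the row-stochastic result applies;
    -- transposition keeps the characteristic polynomial.
    (fun z hz => by
      refine hB.norm_lt_one_of_isRoot_sub hq1 hqb hgapB (z := z) ?_
      rw [← DDPS.charpoly_complexify_transpose] at hz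
      exact hz)
  refine ⟨ε₀, hε₀, fun ε hε _ hεle p X hX _ f Bf _ hBf α hα x y d hrun i => ?_⟩
  obtain ⟨hS, hδ, hη⟩ := h ε hε hεle hX (D := ∑ j, |Bf j|) hrun hα.nonneg hα.tendsto_zero
    fun k j => (hBf j _ _ (hrun.subgradient k j)).trans ((le_abs_self _).trans
      (Finset.single_le_sum (f := fun j => |Bf j|) (fun j _ => abs_nonneg _) (Finset.mem_univ j)))
  constructor
  · have hlim : Tendsto (fun k => ‖DDPS.disagreement w (x k)‖ +
        1 / (n : ℝ) * ‖DDPS.totalGap w (x k) (y k)‖) atTop (𝓝 0) := by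
      simpa using hδ.add (hS.const_mul (1 / (n : ℝ)))
    refine squeeze_zero (fun k => norm_nonneg _) (fun k => ?_) hlim
    rw [DDPS.sub_accumulationState w]
    refine (norm_sub_le _ _).trans (add_le_add (norm_le_pi_norm _ i) ?_)
    rw [norm_smul, Real.norm_of_nonneg (by positivity)]
  · have hlim : Tendsto (fun k => ‖DDPS.totalGap w (x k) (y k)‖ +
        Fintype.card (Fin n) * ‖DDPS.disagreement w (x k)‖ + ‖DDPS.imbalance q (y k)‖)
        atTop (𝓝 0) := by
      simpa using (hS.add (hδ.const_mul (Fintype.card (Fin n) : ℝ))).add hη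
    exact squeeze_zero (fun k => norm_nonneg _) (fun k => (norm_le_pi_norm _ i).trans
      (DDPS.norm_surplus_le (fun i => (hq0 i).le) hq1 w _ _)) hlim
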